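/- Let $M,a\ge 1$ be integers, let $g_0,\dots,g_{M-1}\in\ell^2(\mathbb Z)$ (complex sequences), and set $g_{m,n}(k)=g_m(k-na)$ for $k,n\in\mathbb Z$. Assume that $\{g_{m,n}\}$ is a frame for $\ell^2(\mathbb Z)$ with frame bounds $A,B>0$, i.e. $A\|f\|^2\le\sum_{m,n}|\langle f,g_{m,n}\rangle|^2\le B\|f\|^2$ for all $f\in\ell^2(\mathbb Z)$, that $\|g_m\|=1$ for all $m$, and that, for some integer $s\ge 0$, $g_m(k)=0$ whenever $|k|>s$. Let $Sf=\sum_{m,n}\langle f,g_{m,n}\rangle g_{m,n}$ be the frame operator, $\gamma_m=S^{-1}g_m$ the dual functions, and $P_N$ the orthogonal projection of $\ell^2(\mathbb Z)$ that keeps the entries with index in $[-N,N]$. For $N\in\mathbb N$ let ${}^P\!g_m$ be the $(2N+1)$-periodic sequence with ${}^P\!g_m(k)=g_m(k)$ for $-N\le k\le N$, and consider in the space of $(2N+1)$-periodic sequences (identified with $\mathbb C^{2N+1}$, i.e. with the sequences supported in $[-N,N]$, with the Euclidean norm) the system of the distinct circulant shifts ${}^P\!g_{m,n}(k)={}^P\!g_m(k-na)$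 of the ${}^P\!g_m$ by the multiples of $a$ modulo $2N+1$, each shift taken once; let ${}^P\!S_N$ be its frame operator. (i) For every $N>2s$ the operator ${}^P\!S_N$ is invertible. (ii) Put ${}^P\!\gamma_m^{(N)}={}^P\!S_N^{-1}\,{}^P\!g_m$. As $N\to\infty$ through the integers for which $a$ divides the period $2N+1$, ${}^P\!\gamma_m^{(N)}$ converges to $\gamma_m$ in $\ell^2(\mathbb Z)$ for every $m$. (iii) If $s\ge 1$, $N>3s$ and $a$ divides $2N+1$, then for every $m$ $$\|P_N\gamma_m-{}^P\!\gamma_m^{(N)}\|\le 3\sqrt2\,C\,\lambda^N(\lambda^s-\lambda^{s+1})^{-3},$$ where $\kappa=B/A$, $q=\frac{\sqrt\kappa-1}{\sqrt\kappa+1}$, $\lambda=q^{1/(2s)}$ and $C=\frac1A\max\{2\kappa,(1+\sqrt\kappa)^2\}$. (If $A=B$, then $\lambda=0$ and the right-hand side is read as its limit value $0$.) -/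

import Mathlib

open Filter Topology

noncomputable section

/-! Frames in a complex Hilbert space -/

section Frames

variable {ι H : Type*} [NormedAddCommGroup H] [InnerProductSpace ℂ H]

/-- `φ` is a frame with (not necessarily optimal) frame bounds `A, B > 0`:
`A ‖f‖² ≤ ∑ᵢ |⟨f, φᵢ⟩|² ≤ B ‖f‖²` for all `f`, the sum being convergent. -/
def IsFrame (φ : ι → H) (A B : ℝ) : Prop :=
  0 < A ∧ 0 < B ∧ ∀ f : H, Summable (fun i => ‖inner ℂ (φ i) f‖ ^ 2) ∧
    A * ‖f‖ ^ 2 ≤ ∑' i, ‖inner ℂ (φ i) f‖ ^ 2 ∧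
    ∑' i, ‖inner ℂ (φ i) f‖ ^ 2 ≤ B * ‖f‖ ^ 2

/-- The frame operator `S f = ∑ᵢ ⟨f, φᵢ⟩ φᵢ`
(`inner ℂ` is linear in its second argument). -/
def frameOp (φ : ι → H) (f : H) : H := ∑' i, inner ℂ (φ i) f • φ i

/-- The inverse `S⁻¹` of the frame operator. -/
def frameOpInv (φ : ι → H) : H → H := Function.invFun (frameOp φ)

/-- The frame operator of a frame in a Hilbert space is bijective, so that `frameOpInv` is
its inverse. -/
theorem IsFrame.bijective_frameOp [CompleteSpace H] {φ : ι → H} {A B : ℝ}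
    (h : IsFrame φ A B) : Function.Bijective (frameOp φ) := by
  obtain ⟨hA, hB, hf⟩ := h
  have hmem : ∀ f : H, Memℓp (fun i => inner ℂ (φ i) f) 2 := fun f => by
    refine (memℓp_gen_iff (by norm_num)).2 ?_
    simpa using (hf f).1
  have hex : ∃ F : H →L[ℂ] lp (fun _ : ι => ℂ) 2, ∀ f i, F f i = inner ℂ (φ i) f := by
    let F₀ : H →ₗ[ℂ] lp (fun _ : ι => ℂ) 2 :=
      { toFun := fun f => ⟨fun i => inner ℂ (φ i) f, hmem f⟩
        map_add' := fun x y => lp.ext (funext fun i => inner_add_right _ _ _)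
        map_smul' := fun c x => lp.ext (funext fun i => inner_smul_right _ _ _) }
    have hF₀ : ∀ f, ‖F₀ f‖ ^ 2 = ∑' i, ‖inner ℂ (φ i) f‖ ^ 2 := fun f => by
      have := lp.norm_rpow_eq_tsum (p := 2) (by norm_num) (F₀ f)
      simpa [F₀] using this
    exact ⟨F₀.mkContinuous (Real.sqrt B) (fun f => by
      rw [← Real.sqrt_sq (norm_nonneg f), ← Real.sqrt_mul hB.le]
      exact Real.le_sqrt_of_sq_le (by rw [hF₀]; exact (hf f).2.2)), fun _ _ => rfl⟩
  obtain ⟨F, hF⟩ := hex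
  have hFn : ∀ f, ‖F f‖ ^ 2 = ∑' i, ‖inner ℂ (φ i) f‖ ^ 2 := fun f => by
    have := lp.norm_rpow_eq_tsum (p := 2) (by norm_num) (F f)
    simpa [hF] using this
  obtain ⟨S, hSF⟩ : ∃ S : H →L[ℂ] H, ∀ f, S f = ContinuousLinearMap.adjoint F (F f) :=
    ⟨(ContinuousLinearMap.adjoint F) ∘L F, fun _ => rfl⟩
  classical
  have hsingle : ∀ (i : ι) (c : ℂ),
      ContinuousLinearMap.adjoint F (lp.single 2 i c) = c • φ i := fun i c => by
    refine ext_inner_right ℂ fun x => ?_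
    rw [ContinuousLinearMap.adjoint_inner_left, lp.inner_single_left]
    rw [hF, inner_smul_left, RCLike.inner_apply, mul_comm]
  have hS : ∀ f, frameOp φ f = S f := fun f => by
    have h1 := (lp.hasSum_single (p := 2) (by norm_num) (F f)).mapL
      (ContinuousLinearMap.adjoint F)
    simp only [hsingle, hF] at h1
    rw [hSF]
    exact h1.tsum_eq
  have hcoer : ∀ f, A * ‖f‖ ^ 2 ≤ RCLike.re (inner ℂ (S f) f) := fun f => by
    rw [hSF, ContinuousLinearMap.adjoint_inner_left, inner_self_eq_norm_sq, hFn]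
    exact (hf f).2.1
  have hbelow : ∀ f, A * ‖f‖ ≤ ‖S f‖ := fun f => by
    rcases eq_or_ne f 0 with rfl | hne
    · simp
    · have hpos : 0 < ‖f‖ := norm_pos_iff.2 hne
      have h1 := (hcoer f).trans (re_inner_le_norm (S f) f)
      nlinarith
  have hfun : frameOp φ = S := funext hS
  rw [hfun]
  have hinj : Function.Injective S := by
    refine (injective_iff_map_eq_zero S).2 fun f h0 => ?_
    have := hbelow f
    rw [h0, norm_zero] at this
    exact norm_le_zero_iff.1 (by nlinarith [norm_nonneg f])
  refine ⟨hinj, ?_⟩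
  have hanti : AntilipschitzWith (Real.toNNReal A⁻¹) S :=
    AddMonoidHomClass.antilipschitz_of_bound S fun f => by
      rw [Real.coe_toNNReal _ (inv_pos.2 hA).le, inv_mul_eq_div, le_div_iff₀ hA, mul_comm]
      exact hbelow f
  have hcl : IsClosed (LinearMap.range S.toLinearMap : Set H) := by
    rw [LinearMap.coe_range]
    exact hanti.isClosed_range S.uniformContinuous
  have : LinearMap.range S.toLinearMap = ⊤ := by
    have : (LinearMap.range S.toLinearMap).HasOrthogonalProjection :=
      have := hcl.completeSpace_coe
      inferInstance
    rw [← Submodule.orthogonal_eq_bot_iff, Submodule.eq_bot_iff]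
    intro x hx
    have h0 : inner ℂ (S x) x = 0 := hx (S x) ⟨x, rfl⟩
    have := hcoer x
    rw [h0] at this
    simp only [map_zero] at this
    have hx2 : ‖x‖ ^ 2 ≤ 0 := by nlinarith [sq_nonneg ‖x‖]
    exact norm_eq_zero.1 (by nlinarith [norm_nonneg x])
  exact LinearMap.range_eq_top.1 this

end Frames

/-! Shift-invariant systems in `ℓ²(ℤ)` -/

/-- The Hilbert space `ℓ²(ℤ)` of complex sequences. -/
abbrev L2Z : Type := lp (fun _ : ℤ => ℂ) 2

/-- The translate `k ↦ f (k - j)`. -/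
def seqTranslate (j : ℤ) (f : L2Z) : L2Z :=
  ⟨fun k => f (k - j), by
    have h := (memℓp_gen_iff (by norm_num)).1 f.2
    exact (memℓp_gen_iff (by norm_num)).2 ((Equiv.subRight j).summable_iff.2 h)⟩

/-- The shift-invariant system `g_{m,n}(k) = g_m(k - n a)`, `m = 0, …, M - 1`, `n ∈ ℤ`. -/
def shiftSystem {M : ℕ} (a : ℕ) (g : Fin M → L2Z) (p : Fin M × ℤ) : L2Z :=
  seqTranslate (p.2 * (a : ℤ)) (g p.1)

/-- The dual functions `γ_m = S⁻¹ g_m`. -/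
def dualFun {M : ℕ} (a : ℕ) (g : Fin M → L2Z) (m : Fin M) : L2Z :=
  frameOpInv (shiftSystem a g) (g m)

/-- A sequence that vanishes outside `[-N, N]` is in `ℓ²(ℤ)`. -/
theorem memlp_window (N : ℕ) (x : ℤ → ℂ) :
    Memℓp (fun k : ℤ => if |k| ≤ (N : ℤ) then x k else 0) 2 := by
  refine (memℓp_gen_iff (by norm_num)).2
    (summable_of_ne_finset_zero (s := Finset.Icc (-(N : ℤ)) N) fun k hk => ?_)
  rw [if_neg (fun h => hk (Finset.mem_Icc.2 (abs_le.1 h)))]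
  simp

/-- The orthogonal projection `P_N`, which keeps the entries with index in `[-N, N]`. -/
def truncate (N : ℕ) (f : L2Z) : L2Z :=
  ⟨fun k => if |k| ≤ (N : ℤ) then f k else 0, memlp_window N f⟩

/-! The periodic model of period `2N + 1` -/

/-- Periodic sequences of period `2N + 1` with the Euclidean norm over one period. -/
abbrev PerSpace (N : ℕ) : Type := EuclideanSpace ℂ (ZMod (2 * N + 1))

/-- The periodic extension of `P_N f`: its value on the class of `k ∈ {-N, …, N}` modulo
`2N + 1` is `f k` (`ZMod.valMinAbs` is this representative). -/
def perExt (N : ℕ) (f : L2Z) : PerSpace N :=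
  WithLp.toLp 2 fun c => f c.valMinAbs

/-- The circulant shift `c ↦ x (c - j)`. -/
def circShift {N : ℕ} (j : ZMod (2 * N + 1)) (x : PerSpace N) : PerSpace N :=
  WithLp.toLp 2 fun c => x (c - j)

/-- The periodized system, consisting of the circulant shifts of the periodic extensions of the
`g_m` by the multiples `n a` modulo `2N + 1`, each of these shifts being taken once. -/
def perSystem {M : ℕ} (a N : ℕ) (g : Fin M → L2Z)
    (p : Fin M × AddSubgroup.zmultiples (a : ZMod (2 * N + 1))) : PerSpace N :=
  circShift (p.2 : ZMod (2 * N + 1)) (perExt N (g p.1))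

/-- The periodic duals: the inverse of the frame operator of the periodized system, applied to
the periodic extension of `g_m`. -/
def perDual {M : ℕ} (a N : ℕ) (g : Fin M → L2Z) (m : Fin M) : PerSpace N :=
  frameOpInv (perSystem a N g) (perExt N (g m))

/-- The identification of one period `[-N, N]` of a periodic sequence with an element of the image
of `P_N` in `ℓ²(ℤ)`. -/
def ofPer (N : ℕ) (x : PerSpace N) : L2Z :=
  ⟨fun k => if |k| ≤ (N : ℤ) then x (k : ZMod (2 * N + 1)) else 0,
    memlp_window N fun k => x (k : ZMod (2 * N + 1))⟩

end

/-! Polynomial approximation of the inverse -/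

section Approx

open Polynomial

/-! Both duals are nearly given by one polynomial in the frame operators `S` and `S_N`, and on short
supports periodization cannot tell the two operators apart.

If both spectra lie in `[A, B]`, a rescaled Chebyshev polynomial yields `p` of degree at most `n`
with `|1 - x p(x)| ≤ 2 q ^ (n + 1)` on `[A, B]`; by functional calculus `p(S) g_m` and `p(S_N)` of
the periodized `g_m` lie within `(2 / A) q ^ (n + 1)` of the respective duals
(`norm_sub_aeval_apply_le`).

The spectrum of `S_N` is located by testing the frame inequality on a periodic sequence cut off to
many periods: the boundary terms stay bounded while the interior grows linearly, so the bounds pass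
to the periodized system with a factor `t`, the number of periods around which the multiples of `a`
wind (`IsFrame.perSystem`). This already gives (i); `t = 1` when `a` divides the period.

Each application of `S` widens a support by at most `2s`. When `a` divides the period, `p(S) g_m`
therefore periodizes to `p(S_N)` of the periodized `g_m` as long as `s + 2sn ≤ N` (`perExt_aeval`).
The triangle inequality gives the error `(4 / A) q ^ (n + 1)`, and taking `n` as large as the
support permits gives (ii) and (iii). -/

theorem exists_residual_polynomial {A B : ℝ} (hA : 0 < A) (hAB : A ≤ B) (n : ℕ) :
    ∃ r : ℝ[X], r.natDegree ≤ n + 1 ∧ r.eval 0 = 1 ∧ ∀ x ∈ Set.Icc A B,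
      |r.eval x| ≤ 2 * ((√(B / A) - 1) / (√(B / A) + 1)) ^ (n + 1) := by
  rcases hAB.eq_or_lt with rfl | hlt
  -- For `A = B` the rate is `0`, and a linear polynomial vanishing at `A` attains it.
  · refine ⟨1 - C A⁻¹ * X, ?_, by simp, fun x hx => ?_⟩
    · compute_degree
      omega
    · obtain rfl : x = A := le_antisymm hx.2 hx.1
      simp [hA.ne']
  set t := √(B / A) with ht
  have ht1 : 1 < t := by
    rw [ht, Real.lt_sqrt zero_le_one, one_pow]
    exact (one_lt_div hA).2 hlt
  have hB : B = A * t ^ 2 := by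
    rw [ht, Real.sq_sqrt (div_pos (hA.trans hlt) hA).le]
    field_simp
  set q := (t - 1) / (t + 1) with hq
  have hq0 : 0 < q := div_pos (by linarith) (by linarith)
  -- The image of `0` under the affine map `x ↦ c - 2x / (B - A)`, which carries `[A, B]` onto `[-1,
  -- 1]`. As `c = (q + q⁻¹) / 2`, the Chebyshev polynomial is at least `q ^ (-(n + 1)) / 2` there,
  -- while it stays bounded by `1` on `[-1, 1]`.
  set c := (B + A) / (B - A) with hc
  have hBA : 0 < B - A := sub_pos.2 hlt
  have hcosh : c = Real.cosh (Real.log q⁻¹) := by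
    have h1 : t - 1 ≠ 0 := by linarith
    have h2 : t + 1 ≠ 0 := by linarith
    have h3 : t ^ 2 - 1 ≠ 0 := by nlinarith
    have h4 : A * t ^ 2 - A ≠ 0 := by rw [← hB]; exact hBA.ne'
    rw [Real.cosh_log (inv_pos.2 hq0), hc, hq, hB, inv_inv, inv_div]
    field_simp
    ring
  set T := Chebyshev.T ℝ ((n + 1 : ℕ) : ℤ) with hT
  have hTc : (q ^ (n + 1))⁻¹ / 2 ≤ T.eval c := by
    rw [hcosh, hT, Chebyshev.T_real_cosh, Real.cosh_eq, ← inv_pow]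
    have : Real.exp ((((n + 1 : ℕ) : ℤ) : ℝ) * Real.log q⁻¹) = q⁻¹ ^ (n + 1) := by
      rw [Int.cast_natCast, Real.exp_nat_mul, Real.exp_log (inv_pos.2 hq0)]
    rw [this]
    have := Real.exp_pos (-((((n + 1 : ℕ) : ℤ) : ℝ) * Real.log q⁻¹))
    linarith
  have hqn : 0 < (q ^ (n + 1))⁻¹ := by positivity
  have hTpos : 0 < T.eval c := by linarith
  refine ⟨C (T.eval c)⁻¹ * T.comp (C c - C (2 / (B - A)) * X), ?_, ?_, fun x hx => ?_⟩
  · refine (natDegree_C_mul_le _ _).trans (natDegree_comp_le.trans ?_)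
    have h1 : (C c - C (2 / (B - A)) * X).natDegree ≤ 1 := by compute_degree
    have h2 : T.natDegree = n + 1 := by rw [hT, Chebyshev.natDegree_T]; rfl
    rw [h2]
    nlinarith
  · simp [hTpos.ne']
  · have hy : |c - 2 / (B - A) * x| ≤ 1 := by
      have : c - 2 / (B - A) * x = (B + A - 2 * x) / (B - A) := by
        rw [hc]; field_simp
      rw [this, abs_div, abs_of_pos hBA, div_le_one hBA, abs_le]
      constructor <;> linarith [hx.1, hx.2]
    have h1 := Chebyshev.abs_eval_T_real_le_one ((n + 1 : ℕ) : ℤ) hy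
    have h2 : (T.eval c)⁻¹ ≤ 2 * q ^ (n + 1) := by
      have := inv_anti₀ (by positivity) hTc
      rwa [inv_div, div_inv_eq_mul] at this
    simp only [eval_mul, eval_C, eval_comp, eval_sub, eval_X, abs_mul, abs_inv, abs_of_pos hTpos]
    calc _ ≤ (T.eval c)⁻¹ * 1 := by gcongr
      _ ≤ _ := by simpa using h2

theorem exists_polynomial_approx_inv {A B : ℝ} (hA : 0 < A) (hAB : A ≤ B) (n : ℕ) :
    ∃ p : ℝ[X], p.natDegree ≤ n ∧ ∀ x ∈ Set.Icc A B,
      |1 - p.eval x * x| ≤ 2 * ((√(B / A) - 1) / (√(B / A) + 1)) ^ (n + 1) := by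
  obtain ⟨r, hr, hr0, hrx⟩ := exists_residual_polynomial hA hAB n
  -- Since `r(0) = 1`, the quotient `(1 - r) / X` is a polynomial, and it is `-r.divX`.
  refine ⟨-r.divX, ?_, fun x hx => ?_⟩
  · rw [natDegree_neg, natDegree_divX_eq_natDegree_tsub_one]
    omega
  · have h := congrArg (Polynomial.eval x) (divX_mul_X_add r)
    rw [coeff_zero_eq_eval_zero, hr0] at h
    simp only [eval_add, eval_mul, eval_X, eval_C] at h
    have : 1 - (-r.divX).eval x * x = r.eval x := by
      rw [← h, eval_neg]; ring
    rw [this]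
    exact hrx x hx

variable {H : Type*} [NormedAddCommGroup H] [InnerProductSpace ℂ H] [CompleteSpace H]

theorem norm_sub_aeval_apply_le {S : H →L[ℂ] H} (hS : IsSelfAdjoint S) {A B : ℝ} (hA : 0 < A)
    (hspec : spectrum ℝ S ⊆ Set.Icc A B) (hbelow : ∀ f, A * ‖f‖ ≤ ‖S f‖)
    {p : ℝ[X]} {ε : ℝ} (hε : 0 ≤ ε)
    (hp : ∀ x ∈ Set.Icc A B, |1 - p.eval x * x| ≤ ε) (w : H) :
    ‖w - aeval S p (S w)‖ ≤ ε / A * ‖S w‖ := by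
  have h1 : ‖aeval S (1 - p * X)‖ ≤ ε := by
    rw [← cfc_polynomial (1 - p * X) S hS]
    refine norm_cfc_le hε fun x hx => ?_
    simpa using hp x (hspec hx)
  have h2 : aeval S (1 - p * X) w = w - aeval S p (S w) := by simp
  rw [← h2]
  have hw : ‖w‖ ≤ ‖S w‖ / A := by
    rw [le_div_iff₀ hA, mul_comm]; exact hbelow w
  calc _ ≤ ε * ‖w‖ := ContinuousLinearMap.le_of_opNorm_le _ h1 w
    _ ≤ ε * (‖S w‖ / A) := by gcongr
    _ = _ := by ring

/-- The frame operator as a bounded self-adjoint operator with spectrum in `[A, B]`. -/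
theorem IsFrame.exists_continuousLinearMap {ι : Type*} {φ : ι → H} {A B : ℝ}
    (h : IsFrame φ A B) :
    ∃ S : H →L[ℂ] H, (∀ f, frameOp φ f = S f) ∧ IsSelfAdjoint S ∧
      spectrum ℝ S ⊆ Set.Icc A B ∧ ∀ f, A * ‖f‖ ≤ ‖S f‖ := by
  obtain ⟨hA, hB, hf⟩ := h
  have hmem : ∀ f : H, Memℓp (fun i => inner ℂ (φ i) f) 2 := fun f => by
    refine (memℓp_gen_iff (by norm_num)).2 ?_
    simpa using (hf f).1
  have hex : ∃ F : H →L[ℂ] lp (fun _ : ι => ℂ) 2, ∀ f i, F f i = inner ℂ (φ i) f := by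
    let F₀ : H →ₗ[ℂ] lp (fun _ : ι => ℂ) 2 :=
      { toFun := fun f => ⟨fun i => inner ℂ (φ i) f, hmem f⟩
        map_add' := fun x y => lp.ext (funext fun i => inner_add_right _ _ _)
        map_smul' := fun c x => lp.ext (funext fun i => inner_smul_right _ _ _) }
    have hF₀ : ∀ f, ‖F₀ f‖ ^ 2 = ∑' i, ‖inner ℂ (φ i) f‖ ^ 2 := fun f => by
      have := lp.norm_rpow_eq_tsum (p := 2) (by norm_num) (F₀ f)
      simpa [F₀] using this
    exact ⟨F₀.mkContinuous (Real.sqrt B) (fun f => by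
      rw [← Real.sqrt_sq (norm_nonneg f), ← Real.sqrt_mul hB.le]
      exact Real.le_sqrt_of_sq_le (by rw [hF₀]; exact (hf f).2.2)), fun _ _ => rfl⟩
  obtain ⟨F, hF⟩ := hex
  have hFn : ∀ f, ‖F f‖ ^ 2 = ∑' i, ‖inner ℂ (φ i) f‖ ^ 2 := fun f => by
    have := lp.norm_rpow_eq_tsum (p := 2) (by norm_num) (F f)
    simpa [hF] using this
  let S : H →L[ℂ] H := (ContinuousLinearMap.adjoint F) ∘L F
  have hSF : ∀ f, S f = ContinuousLinearMap.adjoint F (F f) := fun _ => rfl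
  have hsa : IsSelfAdjoint S := by
    rw [ContinuousLinearMap.isSelfAdjoint_iff', ContinuousLinearMap.adjoint_comp,
      ContinuousLinearMap.adjoint_adjoint]
  classical
  have hsingle : ∀ (i : ι) (c : ℂ),
      ContinuousLinearMap.adjoint F (lp.single 2 i c) = c • φ i := fun i c => by
    refine ext_inner_right ℂ fun x => ?_
    rw [ContinuousLinearMap.adjoint_inner_left, lp.inner_single_left]
    rw [hF, inner_smul_left, RCLike.inner_apply, mul_comm]
  have hinner : ∀ f, RCLike.re (inner ℂ (S f) f) = ∑' i, ‖inner ℂ (φ i) f‖ ^ 2 := fun f => by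
    rw [hSF, ContinuousLinearMap.adjoint_inner_left, inner_self_eq_norm_sq, hFn]
  have hreal : ∀ c : ℝ, ∀ f : H, RCLike.re (inner ℂ ((algebraMap ℝ (H →L[ℂ] H) c) f) f)
      = c * ‖f‖ ^ 2 := fun c f => by
    rw [Algebra.algebraMap_eq_smul_one, smul_apply,
      one_apply_eq_self, RCLike.real_smul_eq_coe_smul (K := ℂ), inner_smul_left, RCLike.conj_ofReal,
      RCLike.re_ofReal_mul, inner_self_eq_norm_sq]
  refine ⟨S, fun f => ?_, hsa, fun x hx => ⟨?_, ?_⟩, fun f => ?_⟩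
  · have h1 := (lp.hasSum_single (p := 2) (by norm_num) (F f)).mapL
      (ContinuousLinearMap.adjoint F)
    simp only [hsingle, hF] at h1
    rw [hSF]
    exact h1.tsum_eq
  -- The frame inequalities say `A ≤ S ≤ B` in the Loewner order, which bounds the spectrum.
  · refine (algebraMap_le_iff_le_spectrum hsa).1 ?_ x hx
    rw [ContinuousLinearMap.le_def, ContinuousLinearMap.isPositive_def']
    refine ⟨hsa.sub (IsSelfAdjoint.algebraMap _ (.all A)), fun f => ?_⟩
    rw [ContinuousLinearMap.reApplyInnerSelf_apply, sub_apply,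
      inner_sub_left, map_sub, hinner, hreal]
    linarith [(hf f).2.1]
  · refine (le_algebraMap_iff_spectrum_le hsa).1 ?_ x hx
    rw [ContinuousLinearMap.le_def, ContinuousLinearMap.isPositive_def']
    refine ⟨(IsSelfAdjoint.algebraMap _ (.all B)).sub hsa, fun f => ?_⟩
    rw [ContinuousLinearMap.reApplyInnerSelf_apply, sub_apply,
      inner_sub_left, map_sub, hinner, hreal]
    linarith [(hf f).2.2]
  · rcases eq_or_ne f 0 with rfl | hne
    · simp
    · have hpos : 0 < ‖f‖ := norm_pos_iff.2 hne
      have h1 := (hf f).2.1.trans ((hinner f).symm.le.trans (re_inner_le_norm (S f) f))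
      nlinarith

end Approx

/-! Coefficients with respect to translates and circulant shifts -/

theorem valMinAbs_intCast_of_abs_le {N : ℕ} {k : ℤ} (hk : |k| ≤ (N : ℤ)) :
    ((k : ZMod (2 * N + 1))).valMinAbs = k := by
  rw [ZMod.valMinAbs_spec]
  have := abs_le.1 hk
  refine ⟨rfl, ?_, ?_⟩ <;> push_cast <;> omega

theorem abs_valMinAbs_le {N : ℕ} (c : ZMod (2 * N + 1)) : |c.valMinAbs| ≤ (N : ℤ) := by
  have := ZMod.natAbs_valMinAbs_le c
  rw [Int.abs_eq_natAbs]
  omega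

theorem sum_zmod_eq_sum_Icc {E : Type*} [AddCommMonoid E] (N : ℕ) (F : ZMod (2 * N + 1) → E) :
    ∑ c, F c = ∑ k ∈ Finset.Icc (-(N : ℤ)) N, F k := by
  refine Finset.sum_nbij' (fun c => c.valMinAbs) (fun k => (k : ZMod (2 * N + 1))) ?_ ?_ ?_ ?_ ?_
  · intro c _
    exact Finset.mem_Icc.2 (abs_le.1 (abs_valMinAbs_le c))
  · simp
  · simp
  · intro k hk
    exact valMinAbs_intCast_of_abs_le (abs_le.2 (Finset.mem_Icc.1 hk))
  · simp

theorem sum_Icc_eq_of_support {E : Type*} [AddCommMonoid E] {s N : ℕ} (hsN : s ≤ N) {F : ℤ → E}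
    (hF : ∀ k : ℤ, (s : ℤ) < |k| → F k = 0) :
    ∑ k ∈ Finset.Icc (-(N : ℤ)) N, F k = ∑ k ∈ Finset.Icc (-(s : ℤ)) s, F k := by
  refine (Finset.sum_subset (Finset.Icc_subset_Icc (by omega) (by omega)) fun k _ hk => ?_).symm
  exact hF k (not_le.1 fun h => hk (Finset.mem_Icc.2 (abs_le.1 h)))

theorem inner_seqTranslate {s : ℕ} {g : L2Z} (hg : ∀ k : ℤ, (s : ℤ) < |k| → g k = 0)
    (j : ℤ) (f : L2Z) :
    inner ℂ (seqTranslate j g) f = ∑ k ∈ Finset.Icc (-(s : ℤ)) s, inner ℂ (g k) (f (k + j)) := by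
  rw [lp.inner_eq_tsum, ← (Equiv.addRight j).tsum_eq, tsum_eq_sum]
  · refine Finset.sum_congr rfl fun k _ => ?_
    simp [seqTranslate]
  · intro k hk
    have : g k = 0 := hg k (not_le.1 fun h => hk (Finset.mem_Icc.2 (abs_le.1 h)))
    simp [seqTranslate, this]

theorem inner_circShift_perExt {s N : ℕ} (hsN : s ≤ N) {g : L2Z}
    (hg : ∀ k : ℤ, (s : ℤ) < |k| → g k = 0) (j : ZMod (2 * N + 1)) (x : PerSpace N) :
    inner ℂ (circShift j (perExt N g)) x =
      ∑ k ∈ Finset.Icc (-(s : ℤ)) s, inner ℂ (g k) (x ((k : ZMod (2 * N + 1)) + j)) := by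
  rw [PiLp.inner_apply, ← Equiv.sum_comp (Equiv.addRight j), sum_zmod_eq_sum_Icc,
    ← sum_Icc_eq_of_support hsN]
  · refine Finset.sum_congr rfl fun k hk => ?_
    simp only [circShift, perExt, Equiv.coe_addRight, add_sub_cancel_right]
    rw [valMinAbs_intCast_of_abs_le (abs_le.2 (Finset.mem_Icc.1 hk))]
  · intro k hk
    rw [hg k hk, inner_zero_left]

theorem perSpace_norm_sq (N : ℕ) (x : PerSpace N) : ‖x‖ ^ 2 = ∑ c, ‖x c‖ ^ 2 :=
  EuclideanSpace.norm_sq_eq x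

theorem L2Z_norm_sq (f : L2Z) : ‖f‖ ^ 2 = ∑' k, ‖f k‖ ^ 2 := by
  have := lp.norm_rpow_eq_tsum (p := 2) (by norm_num) f
  simpa using this

/-! Sums of periodic functions -/

theorem sum_range_mul_of_periodic {h : ℕ → ℝ} {P : ℕ} (hh : Function.Periodic h P) (c K : ℕ) :
    ∑ i ∈ Finset.range (K * P), h (c * P + i) = K * ∑ i ∈ Finset.range P, h i := by
  have hp : ∀ (c i : ℕ), h (c * P + i) = h i := fun c i => by
    rw [add_comm]; exact hh.nat_mul c i
  simp only [hp]
  induction K with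
  | zero => simp
  | succ K ih =>
    rw [Nat.succ_mul, Finset.sum_range_add, ih]
    simp only [hp]
    push_cast; ring

theorem sum_range_zmod (N : ℕ) (F : ZMod (2 * N + 1) → ℝ) :
    ∑ i ∈ Finset.range (2 * N + 1), F i = ∑ c, F c := by
  refine Finset.sum_nbij' (fun i => (i : ZMod (2 * N + 1))) (fun c => c.val) ?_ ?_ ?_ ?_ ?_
  · simp
  · intro c _
    exact Finset.mem_range.2 (ZMod.val_lt c)
  · intro i hi
    exact ZMod.val_natCast_of_lt (Finset.mem_range.1 hi)
  · simp
  · simp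

theorem nonpos_of_forall_natCast_mul_le {u e : ℝ} (h : ∀ K : ℕ, K * u ≤ e) : u ≤ 0 := by
  by_contra! hu
  obtain ⟨K, hK⟩ := exists_nat_gt (e / u)
  rw [div_lt_iff₀ hu] at hK
  exact absurd (h K) (not_le.2 hK)

/-! The periodized system is a frame -/

/-- The restriction of a periodic sequence to `K + 2` consecutive blocks of length `P`. -/
noncomputable def blockRestrict {N : ℕ} (x : PerSpace N) (P K : ℕ) : L2Z :=
  ⟨fun k => if (P : ℤ) ≤ k ∧ k < ((K + 3) * P : ℕ) then x (k : ZMod (2 * N + 1)) else 0, by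
    refine (memℓp_gen_iff (by norm_num)).2 (summable_of_ne_finset_zero
      (s := Finset.Ico (P : ℤ) ((K + 3) * P : ℕ)) fun k hk => ?_)
    rw [if_neg (fun h => hk (Finset.mem_Ico.2 h))]
    simp⟩

theorem blockRestrict_apply {N : ℕ} (x : PerSpace N) (P K : ℕ) (k : ℤ) :
    blockRestrict x P K k =
      if (P : ℤ) ≤ k ∧ k < ((K + 3) * P : ℕ) then x (k : ZMod (2 * N + 1)) else 0 := rfl

theorem blockRestrict_norm_sq {N : ℕ} (x : PerSpace N) (t K : ℕ) :
    ‖blockRestrict x (t * (2 * N + 1)) K‖ ^ 2 = (K + 2) * (t * ‖x‖ ^ 2) := by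
  set P := t * (2 * N + 1) with hP
  have hper1 : Function.Periodic (fun i : ℕ => ‖x (i : ZMod (2 * N + 1))‖ ^ 2) (2 * N + 1) := by
    intro i
    have : ((2 * N + 1 : ℕ) : ZMod (2 * N + 1)) = 0 := ZMod.natCast_self _
    simp only [Nat.cast_add i, this, add_zero]
  have hper : Function.Periodic (fun i : ℕ => ‖x (i : ZMod (2 * N + 1))‖ ^ 2) P :=
    hper1.nat_mul t
  have hone : ∑ i ∈ Finset.range P, ‖x (i : ZMod (2 * N + 1))‖ ^ 2 = t * ‖x‖ ^ 2 := by
    have := sum_range_mul_of_periodic hper1 0 t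
    simp only [zero_mul, zero_add] at this
    rw [this, sum_range_zmod N (fun c => ‖x c‖ ^ 2), perSpace_norm_sq]
  rw [L2Z_norm_sq, ← (Nat.cast_injective (R := ℤ)).tsum_eq, tsum_eq_sum
    (s := Finset.range (P + (K + 2) * P)), Finset.sum_range_add, Finset.sum_eq_zero, zero_add]
  · have h := sum_range_mul_of_periodic hper 1 (K + 2)
    rw [hone, one_mul] at h
    push_cast at h
    rw [← h]
    refine Finset.sum_congr rfl fun i hi => ?_
    rw [blockRestrict_apply, if_pos]
    · push_cast; rfl
    · rw [Finset.mem_range] at hi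
      constructor
      · omega
      · have : P + i < (K + 3) * P := by nlinarith
        exact_mod_cast this
  · intro i hi
    rw [Finset.mem_range] at hi
    rw [blockRestrict_apply, if_neg (by omega)]
    simp
  · intro i hi
    rw [Finset.mem_range, not_lt] at hi
    rw [blockRestrict_apply, if_neg]
    · simp
    · rintro ⟨_, h⟩
      have h' : i < (K + 3) * P := by exact_mod_cast h
      nlinarith
  · intro k hk
    rw [Function.mem_support, blockRestrict_apply] at hk
    have : 0 ≤ k := by
      by_contra hneg
      rw [if_neg (by omega)] at hk
      simp at hk
    exact ⟨k.toNat, by simp [this]⟩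

theorem norm_blockRestrict_apply_le {N : ℕ} (x : PerSpace N) (P K : ℕ) (k : ℤ) :
    ‖blockRestrict x P K k‖ ≤ ‖x‖ := by
  rw [blockRestrict_apply]
  split_ifs
  · exact PiLp.norm_apply_le x _
  · simp

theorem tsum_perSystem {M : ℕ} (a N : ℕ) (g : Fin M → L2Z) (x : PerSpace N) :
    ∑' p, ‖inner ℂ (perSystem a N g p) x‖ ^ 2 =
      ∑ m, ∑ i ∈ Finset.range (addOrderOf (a : ZMod (2 * N + 1))),
        ‖inner ℂ (circShift ((i * a : ℕ) : ZMod (2 * N + 1)) (perExt N (g m))) x‖ ^ 2 := by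
  rw [← ((Equiv.refl (Fin M)).prodCongr (finEquivZMultiples
    (isOfFinAddOrder_of_finite (a : ZMod (2 * N + 1))))).tsum_eq, tsum_fintype, Fintype.sum_prod_type]
  refine Finset.sum_congr rfl fun m _ => ?_
  rw [← Fin.sum_univ_eq_sum_range
    (fun i : ℕ => ‖inner ℂ (circShift ((i * a : ℕ) : ZMod (2 * N + 1)) (perExt N (g m))) x‖ ^ 2)]
  refine Finset.sum_congr rfl fun i _ => ?_
  simp [perSystem, finEquivZMultiples_apply]

/-- If every `g_m` is supported in `[-s, s]` with `s ≤ N`, the periodized system of period `2 N + 1`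
is a frame; `t` is the number of periods that the multiples of `a` need to close up. -/
theorem IsFrame.perSystem {M a : ℕ} (ha : 0 < a) {g : Fin M → L2Z} {A B : ℝ}
    (hframe : IsFrame (shiftSystem a g) A B) {s N : ℕ}
    (hsupp : ∀ (m : Fin M) (k : ℤ), (s : ℤ) < |k| → g m k = 0) (hsN : s ≤ N) {t : ℕ}
    (ht : addOrderOf (a : ZMod (2 * N + 1)) * a = t * (2 * N + 1)) :
    IsFrame (perSystem a N g) (t * A) (t * B) := by
  obtain ⟨hA, hB, hf⟩ := hframe
  set R := addOrderOf (a : ZMod (2 * N + 1)) with hR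
  have hRpos : 0 < R := (isOfFinAddOrder_of_finite (a : ZMod (2 * N + 1))).addOrderOf_pos
  have htpos : 0 < t := by
    rcases Nat.eq_zero_or_pos t with h | h
    · rw [h, zero_mul] at ht
      exact absurd ht (Nat.mul_pos hRpos ha).ne'
    · exact h
  have htR : (0 : ℝ) < t := by exact_mod_cast htpos
  refine ⟨mul_pos htR hA, mul_pos htR hB, fun x => ⟨?_, ?_⟩⟩
  · exact (hasSum_fintype _).summable
  rw [tsum_perSystem, ← hR]
  set G : Fin M → ℕ → ℝ := fun m i =>
    ‖inner ℂ (circShift ((i * a : ℕ) : ZMod (2 * N + 1)) (perExt N (g m))) x‖ ^ 2 with hG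
  have hGper : ∀ m, Function.Periodic (G m) R := fun m i => by
    have : ((R * a : ℕ) : ZMod (2 * N + 1)) = 0 := by
      rw [ht, Nat.cast_mul, ZMod.natCast_self, mul_zero]
    simp only [hG, add_mul, Nat.cast_add, this, add_zero]
  set Q := ∑ m, ∑ i ∈ Finset.range R, G m i with hQ
  set P := t * (2 * N + 1) with hP
  have hsP : s < P := by nlinarith
  -- Bound for the boundary: for each `m` at most `2R` shifts at either end see the cutoff. It does
  -- not depend on `K`.
  set W : ℝ := ∑ m, 4 * R * (∑ k ∈ Finset.Icc (-(s : ℤ)) s, ‖g m k‖ * ‖x‖) ^ 2 with hW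
  have key : ∀ K : ℕ, ∃ e : ℝ, 0 ≤ e ∧ e ≤ W ∧
      ∑' p, ‖inner ℂ (shiftSystem a g p) (blockRestrict x P K)‖ ^ 2 = K * Q + e := by
    intro K
    set f := blockRestrict x P K with hfdef
    set F : Fin M → ℕ → ℝ := fun m i => ‖inner ℂ (seqTranslate ((i : ℤ) * a) (g m)) f‖ ^ 2 with hF
    have hFbound : ∀ m i, F m i ≤ (∑ k ∈ Finset.Icc (-(s : ℤ)) s, ‖g m k‖ * ‖x‖) ^ 2 := by
      intro m i
      simp only [hF]
      rw [inner_seqTranslate (hsupp m)]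
      gcongr
      refine (norm_sum_le _ _).trans (Finset.sum_le_sum fun k _ => ?_)
      refine (norm_inner_le_norm _ _).trans ?_
      gcongr
      exact norm_blockRestrict_apply_le x P K _
    -- The blocks start at `P > s` rather than at `0`, so no negative shift meets them and the sum
    -- runs over natural numbers only.
    have hzero : ∀ (m : Fin M) (n : ℤ), (n < 0 ∨ ((K + 4) * R : ℕ) ≤ n) →
        inner ℂ (seqTranslate (n * a) (g m)) f = 0 := by
      intro m n hn
      rw [inner_seqTranslate (hsupp m)]
      refine Finset.sum_eq_zero fun k hk => ?_
      rw [Finset.mem_Icc] at hk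
      rw [hfdef, blockRestrict_apply, if_neg, inner_zero_right]
      rintro ⟨h1, h2⟩
      rcases hn with hn | hn
      · have : n * a ≤ 0 := by
          exact mul_nonpos_of_nonpos_of_nonneg hn.le (by positivity)
        omega
      · have h3 : (((K + 4) * R : ℕ) : ℤ) * a ≤ n * a := by gcongr
        have h4 : (((K + 4) * R : ℕ) : ℤ) * a = ((K + 3) * P : ℕ) + P := by
          rw [← ht]; push_cast; ring
        omega
    -- As `R * a = P`, these shifts move by amounts in `[2P, (K + 2)P]`; their windows, widened by
    -- `s < P`, stay inside the blocks, where the cutoff agrees with the periodic sequence.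
    have hmid : ∀ m i, i < K * R → F m (2 * R + i) = G m (2 * R + i) := by
      intro m i hi
      simp only [hF, hG]
      rw [inner_seqTranslate (hsupp m), inner_circShift_perExt hsN (hsupp m)]
      congr 2
      refine Finset.sum_congr rfl fun k hk => ?_
      rw [Finset.mem_Icc] at hk
      rw [hfdef, blockRestrict_apply, if_pos]
      · push_cast; rfl
      · have h1 : 2 * P ≤ (2 * R + i) * a := by
          rw [← ht]; nlinarith
        have h2 : (2 * R + i) * a ≤ (K + 2) * P := by
          rw [← ht, ← mul_assoc]
          gcongr
          nlinarith
        have h3 : (K + 3) * P = (K + 2) * P + P := by ring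
        have h4 : (((2 * R + i : ℕ) : ℤ)) * a = ((2 * R + i) * a : ℕ) := by push_cast; ring
        rw [h4, h3]
        constructor <;> omega
    have htsum : ∑' p, ‖inner ℂ (shiftSystem a g p) f‖ ^ 2 =
        ∑ m, ∑ i ∈ Finset.range (2 * R + K * R + 2 * R), F m i := by
      have hinj : Function.Injective (fun p : Fin M × ℕ => ((p.1, (p.2 : ℤ)) : Fin M × ℤ)) := by
        rintro ⟨m, i⟩ ⟨m', i'⟩ h
        simpa using h
      rw [← hinj.tsum_eq, tsum_eq_sum
        (s := Finset.univ ×ˢ Finset.range (2 * R + K * R + 2 * R)), Finset.sum_product]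
      · rfl
      · rintro ⟨m, i⟩ hp
        simp only [Finset.mem_product, Finset.mem_univ, true_and, Finset.mem_range, not_lt] at hp
        simp only [shiftSystem]
        rw [hzero m i (Or.inr ?_)]
        · simp
        · have : (K + 4) * R ≤ i := by linarith
          exact_mod_cast this
      · rintro ⟨m, n⟩ hp
        have : 0 ≤ n := by
          by_contra! hneg
          simp only [Function.mem_support, shiftSystem] at hp
          rw [hzero m n (Or.inl hneg)] at hp
          simp at hp
        exact ⟨(m, n.toNat), by simp [this]⟩
    refine ⟨∑ m, (∑ i ∈ Finset.range (2 * R), F m i +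
      ∑ i ∈ Finset.range (2 * R), F m (2 * R + K * R + i)), ?_, ?_, ?_⟩
    · exact Finset.sum_nonneg fun m _ => add_nonneg
        (Finset.sum_nonneg fun i _ => sq_nonneg _) (Finset.sum_nonneg fun i _ => sq_nonneg _)
    · refine Finset.sum_le_sum fun m _ => ?_
      have h1 := Finset.sum_le_card_nsmul (Finset.range (2 * R)) (F m) _ fun i _ => hFbound m i
      have h2 := Finset.sum_le_card_nsmul (Finset.range (2 * R)) (fun i => F m (2 * R + K * R + i))
        _ fun i _ => hFbound m _
      rw [Finset.card_range, nsmul_eq_mul] at h1 h2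
      push_cast at h1 h2
      linarith
    · rw [htsum, hQ, Finset.mul_sum, ← Finset.sum_add_distrib]
      refine Finset.sum_congr rfl fun m _ => ?_
      rw [Finset.sum_range_add, Finset.sum_range_add, ← sum_range_mul_of_periodic (hGper m) 2 K,
        Finset.sum_congr rfl fun i hi => hmid m i (Finset.mem_range.1 hi)]
      ring
  constructor
  -- The terms linear in `K` must satisfy the inequality on their own, since the rest is bounded.
  · refine sub_nonpos.1 (nonpos_of_forall_natCast_mul_le (e := W) fun K => ?_)
    obtain ⟨e, he0, heW, he⟩ := key K
    have h1 := (hf (blockRestrict x P K)).2.1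
    rw [he, blockRestrict_norm_sq] at h1
    have : 0 ≤ A * (t * ‖x‖ ^ 2) := by positivity
    nlinarith
  · refine sub_nonpos.1 (nonpos_of_forall_natCast_mul_le (e := 2 * (B * (t * ‖x‖ ^ 2))) fun K => ?_)
    obtain ⟨e, he0, heW, he⟩ := key K
    have h1 := (hf (blockRestrict x P K)).2.2
    rw [he, blockRestrict_norm_sq] at h1
    nlinarith

theorem exists_addOrderOf_mul_eq (a N : ℕ) :
    ∃ t, addOrderOf (a : ZMod (2 * N + 1)) * a = t * (2 * N + 1) := by
  have h := addOrderOf_nsmul_eq_zero (a : ZMod (2 * N + 1))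
  rw [nsmul_eq_mul, ← Nat.cast_mul, ZMod.natCast_eq_zero_iff] at h
  obtain ⟨t, ht⟩ := h
  exact ⟨t, by rw [ht, mul_comm]⟩

/-- This is the case `t = 1`: the periodized system keeps the bounds `A, B`, so the same polynomial
serves both operators. -/
theorem addOrderOf_mul_eq_of_dvd {a N : ℕ} (h : a ∣ 2 * N + 1) :
    addOrderOf (a : ZMod (2 * N + 1)) * a = 2 * N + 1 := by
  refine Nat.dvd_antisymm ?_ ?_
  · obtain ⟨b, hb⟩ := h
    have hdvd : addOrderOf (a : ZMod (2 * N + 1)) ∣ b := by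
      refine addOrderOf_dvd_of_nsmul_eq_zero ?_
      rw [nsmul_eq_mul, ← Nat.cast_mul, ZMod.natCast_eq_zero_iff, hb, mul_comm]
    calc _ ∣ b * a := Nat.mul_dvd_mul_right hdvd a
      _ = _ := by rw [hb, mul_comm]
  · obtain ⟨t, ht⟩ := exists_addOrderOf_mul_eq a N
    exact ⟨t, by rw [ht, mul_comm]⟩

/-! Periodization intertwines the frame operators on short supports -/

/-- The translated support still fits into one period, so nothing wraps around. -/
theorem circShift_perExt {s N : ℕ} (hsN : s ≤ N) {g : L2Z}
    (hg : ∀ k : ℤ, (s : ℤ) < |k| → g k = 0) {j : ℤ} (hj : |j| + s ≤ (N : ℤ)) :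
    circShift (j : ZMod (2 * N + 1)) (perExt N g) = perExt N (seqTranslate j g) := by
  ext c
  change g (c - (j : ZMod (2 * N + 1))).valMinAbs = g (c.valMinAbs - j)
  set w := (c - (j : ZMod (2 * N + 1))).valMinAbs with hw
  have hwc : ((w + j : ℤ) : ZMod (2 * N + 1)) = c := by
    rw [Int.cast_add, hw, ZMod.coe_valMinAbs, sub_add_cancel]
  by_cases h : |w| ≤ (s : ℤ)
  · have h1 : |w + j| ≤ (N : ℤ) := (abs_add_le _ _).trans (by omega)
    have h2 := valMinAbs_intCast_of_abs_le h1
    rw [hwc] at h2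
    rw [h2, add_sub_cancel_right]
  · rw [hg w (not_le.1 h)]
    symm
    by_contra hne
    have h1 : |c.valMinAbs - j| ≤ (s : ℤ) := not_lt.1 fun h1 => hne (hg _ h1)
    have h2 : ((c.valMinAbs - j : ℤ) : ZMod (2 * N + 1)).valMinAbs = c.valMinAbs - j :=
      valMinAbs_intCast_of_abs_le (h1.trans (by exact_mod_cast hsN))
    rw [Int.cast_sub, ZMod.coe_valMinAbs, ← hw] at h2
    exact h (h2 ▸ h1)

/-- Periodic extension of the restriction to `[-N, N]`, as a linear map. -/
noncomputable def perExtLinear (N : ℕ) : L2Z →ₗ[ℂ] PerSpace N where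
  toFun := perExt N
  map_add' _ _ := rfl
  map_smul' _ _ := rfl

theorem perExtLinear_apply (N : ℕ) (f : L2Z) : perExtLinear N f = perExt N f := rfl

section Intertwine

variable {M a : ℕ} {g : Fin M → L2Z} {s r : ℕ}

/-- The shifts by multiples of `a` of size at most `b`. -/
noncomputable def shiftIndices (a b : ℕ) : Finset ℤ :=
  (Finset.Icc (-(b : ℤ)) b).filter fun n => |n * a| ≤ (b : ℤ)

theorem mem_shiftIndices (ha : 0 < a) {b : ℕ} {n : ℤ} :
    n ∈ shiftIndices a b ↔ |n * a| ≤ (b : ℤ) := by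
  rw [shiftIndices, Finset.mem_filter, Finset.mem_Icc, ← abs_le, and_iff_right_iff_imp]
  intro h
  rw [abs_mul, Nat.abs_cast] at h
  have : (1 : ℤ) ≤ a := by exact_mod_cast ha
  nlinarith [abs_nonneg n]

theorem frameOp_shiftSystem_eq_sum (ha : 0 < a)
    (hsupp : ∀ (m : Fin M) (k : ℤ), (s : ℤ) < |k| → g m k = 0) {f : L2Z}
    (hf : ∀ k : ℤ, (r : ℤ) < |k| → f k = 0) :
    frameOp (shiftSystem a g) f = ∑ p ∈ Finset.univ ×ˢ shiftIndices a (r + s),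
      inner ℂ (shiftSystem a g p) f • shiftSystem a g p := by
  refine tsum_eq_sum fun p hp => ?_
  simp only [Finset.mem_product, Finset.mem_univ, true_and, mem_shiftIndices ha, not_le] at hp
  rw [shiftSystem, inner_seqTranslate (hsupp p.1), Finset.sum_eq_zero, zero_smul]
  intro k hk
  rw [Finset.mem_Icc, ← abs_le] at hk
  rw [hf, inner_zero_right]
  have := abs_sub_abs_le_abs_sub (p.2 * (a : ℤ)) (-k)
  rw [abs_neg, sub_neg_eq_add, add_comm (p.2 * (a : ℤ))] at this
  push_cast at hp
  omega

theorem frameOp_shiftSystem_support (ha : 0 < a)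
    (hsupp : ∀ (m : Fin M) (k : ℤ), (s : ℤ) < |k| → g m k = 0) {f : L2Z}
    (hf : ∀ k : ℤ, (r : ℤ) < |k| → f k = 0) {k : ℤ} (hk : ((r + 2 * s : ℕ) : ℤ) < |k|) :
    frameOp (shiftSystem a g) f k = 0 := by
  rw [frameOp_shiftSystem_eq_sum ha hsupp hf, lp.coeFn_sum, Finset.sum_apply]
  refine Finset.sum_eq_zero fun p hp => ?_
  simp only [Finset.mem_product, Finset.mem_univ, true_and, mem_shiftIndices ha] at hp
  rw [lp.coeFn_smul, Pi.smul_apply]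
  have : shiftSystem a g p k = 0 := by
    refine hsupp p.1 (k - p.2 * a) ?_
    have := abs_sub_abs_le_abs_sub k (p.2 * a)
    push_cast at hp hk
    omega
  rw [this, smul_zero]

theorem intCast_mul_mem_zmultiples {L : ℕ} (n : ℤ) :
    ((n * a : ℤ) : ZMod L) ∈ AddSubgroup.zmultiples (a : ZMod L) :=
  AddSubgroup.mem_zmultiples_iff.2 ⟨n, by simp⟩

/-- The two sums agree term by term under `n ↦ n a` modulo `2N + 1`: only shifts with `|n a| ≤ r +
s` meet the support of `f`, these are distinct modulo the period, and their windows do not wrap. -/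
theorem frameOp_perSystem_perExt (ha : 0 < a)
    (hsupp : ∀ (m : Fin M) (k : ℤ), (s : ℤ) < |k| → g m k = 0) {f : L2Z}
    (hf : ∀ k : ℤ, (r : ℤ) < |k| → f k = 0) {N : ℕ} (hN : r + 2 * s ≤ N) (haN : a ∣ 2 * N + 1) :
    frameOp (perSystem a N g) (perExt N f) = perExt N (frameOp (shiftSystem a g) f) := by
  have hsN : s ≤ N := by omega
  rw [frameOp_shiftSystem_eq_sum ha hsupp hf, ← perExtLinear_apply, ← perExtLinear_apply,
    map_sum, frameOp, tsum_fintype]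
  symm
  refine Finset.sum_of_injOn
    (fun p : Fin M × ℤ => (p.1, (⟨((p.2 * a : ℤ) : ZMod (2 * N + 1)),
      intCast_mul_mem_zmultiples p.2⟩ : AddSubgroup.zmultiples (a : ZMod (2 * N + 1))))) ?_ ?_ ?_ ?_
  · rintro ⟨m, n⟩ hn ⟨m', n'⟩ hn' h
    simp only [Finset.coe_product, Set.mem_prod, Finset.mem_coe, mem_shiftIndices ha] at hn hn'
    have h1 : m = m' := congrArg Prod.fst h
    have h3 : ((n * a : ℤ) : ZMod (2 * N + 1)).valMinAbs =
        ((n' * a : ℤ) : ZMod (2 * N + 1)).valMinAbs :=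
      congrArg (fun p => (p.2 : ZMod (2 * N + 1)).valMinAbs) h
    have hn2 := hn.2
    have hn2' := hn'.2
    push_cast at hn2 hn2'
    rw [valMinAbs_intCast_of_abs_le (by omega), valMinAbs_intCast_of_abs_le (by omega)] at h3
    have : n = n' := mul_right_cancel₀ (by exact_mod_cast ha.ne') h3
    exact Prod.ext h1 this
  · exact fun _ _ => Finset.mem_coe.2 (Finset.mem_univ _)
  · rintro ⟨m, j, hj⟩ _ hnot
    have : inner ℂ (circShift j (perExt N (g m))) (perExtLinear N f) = 0 := by
      rw [inner_circShift_perExt hsN (hsupp m)]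
      refine Finset.sum_eq_zero fun k hk => ?_
      rw [Finset.mem_Icc, ← abs_le] at hk
      by_contra hne
      apply hnot
      set v := ((k : ZMod (2 * N + 1)) + j).valMinAbs with hv
      have hvr : |v| ≤ (r : ℤ) := by
        refine not_lt.1 fun h => hne ?_
        change inner ℂ (g m k) (f v) = 0
        rw [hf v h, inner_zero_right]
      have hvj : ((v - k : ℤ) : ZMod (2 * N + 1)) = j := by
        rw [Int.cast_sub, hv, ZMod.coe_valMinAbs, add_sub_cancel_left]
      obtain ⟨i, hi⟩ := AddSubgroup.mem_zmultiples_iff.1 hj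
      -- Divisibility of the period by `a` enters here: every integer representing a class in the
      -- subgroup generated by `a` is itself a multiple of `a`.
      have hdvd : (a : ℤ) ∣ v - k := by
        have h1 : ((v - k - i * a : ℤ) : ZMod (2 * N + 1)) = 0 := by
          rw [Int.cast_sub, hvj, ← hi]; simp
        rw [ZMod.intCast_zmod_eq_zero_iff_dvd] at h1
        have h2 : (a : ℤ) ∣ ((2 * N + 1 : ℕ) : ℤ) := by exact_mod_cast haN
        have := (h2.trans h1).add (Dvd.intro_left i rfl : (a : ℤ) ∣ i * a)
        simpa using this
      obtain ⟨n, hn⟩ := hdvd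
      rw [mul_comm] at hn
      refine ⟨(m, n), ?_, ?_⟩
      · simp only [Finset.coe_product, Set.mem_prod, Finset.mem_coe, mem_shiftIndices ha]
        refine ⟨Finset.mem_univ _, ?_⟩
        rw [← hn]
        have := abs_sub v k
        push_cast
        omega
      · simp only [← hn, hvj]
    simp only [perSystem, this, zero_smul]
  · rintro ⟨m, n⟩ hn
    simp only [Finset.mem_product, Finset.mem_univ, true_and, mem_shiftIndices ha] at hn
    push_cast at hn
    have h1 : perSystem a N g (m, ⟨((n * a : ℤ) : ZMod (2 * N + 1)), intCast_mul_mem_zmultiples n⟩) =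
        perExt N (shiftSystem a g (m, n)) :=
      circShift_perExt hsN (hsupp m) (by omega)
    rw [h1, map_smul]
    congr 1
    rw [← h1]
    simp only [shiftSystem, perSystem]
    rw [inner_seqTranslate (hsupp m), inner_circShift_perExt hsN (hsupp m)]
    refine Finset.sum_congr rfl fun k hk => ?_
    rw [Finset.mem_Icc, ← abs_le] at hk
    change inner ℂ (g m k) (f (k + n * a)) =
      inner ℂ (g m k) (f ((k : ZMod (2 * N + 1)) + ((n * a : ℤ) : ZMod (2 * N + 1))).valMinAbs)
    rw [← Int.cast_add, valMinAbs_intCast_of_abs_le]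
    have := abs_add_le k (n * a)
    omega

/-- By induction `S ^ i f` is supported in `[-(r + 2si), r + 2si]`, so the intertwining relation
applies to every power up to `n`. -/
theorem perExt_aeval (ha : 0 < a)
    (hsupp : ∀ (m : Fin M) (k : ℤ), (s : ℤ) < |k| → g m k = 0) {N : ℕ} (haN : a ∣ 2 * N + 1)
    {S : L2Z →L[ℂ] L2Z} (hS : ∀ f, frameOp (shiftSystem a g) f = S f)
    {T : PerSpace N →L[ℂ] PerSpace N} (hT : ∀ f, frameOp (perSystem a N g) f = T f)
    {f : L2Z} (hf : ∀ k : ℤ, (r : ℤ) < |k| → f k = 0)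
    {p : Polynomial ℝ} {n : ℕ} (hp : p.natDegree ≤ n) (hn : r + 2 * s * n ≤ N) :
    perExt N (Polynomial.aeval S p f) = Polynomial.aeval T p (perExt N f) := by
  have hpow : ∀ i : ℕ, r + 2 * s * i ≤ N → perExt N ((S ^ i) f) = (T ^ i) (perExt N f) ∧
      ∀ k : ℤ, ((r + 2 * s * i : ℕ) : ℤ) < |k| → (S ^ i) f k = 0 := by
    intro i
    induction i with
    | zero => exact fun _ => ⟨rfl, by simpa using hf⟩
    | succ i ih =>
      intro hi
      obtain ⟨h1, h2⟩ := ih (by nlinarith)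
      have e1 : (S ^ (i + 1)) f = S ((S ^ i) f) := by rw [pow_succ']; rfl
      have e2 : (T ^ (i + 1)) (perExt N f) = T ((T ^ i) (perExt N f)) := by rw [pow_succ']; rfl
      refine ⟨?_, fun k hk => ?_⟩
      · rw [e1, e2, ← h1, ← hS, ← hT]
        exact (frameOp_perSystem_perExt ha hsupp h2 (by linarith) haN).symm
      · rw [e1, ← hS]
        exact frameOp_shiftSystem_support ha hsupp h2 (by convert hk using 2; ring)
  rw [Polynomial.aeval_eq_sum_range' (Nat.lt_succ_of_le hp),
    Polynomial.aeval_eq_sum_range' (Nat.lt_succ_of_le hp), ← perExtLinear_apply,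
    sum_apply, sum_apply, map_sum]
  refine Finset.sum_congr rfl fun i hi => ?_
  have hin : i ≤ n := Nat.lt_succ_iff.1 (Finset.mem_range.1 hi)
  have h := (hpow i ((Nat.add_le_add_left (Nat.mul_le_mul_left _ hin) r).trans hn)).1
  rw [smul_apply, smul_apply, LinearMap.map_smul_of_tower, perExtLinear_apply, h]

end Intertwine

/-! Norms of periodic extensions and of one period -/

theorem norm_ofPer {N : ℕ} (x : PerSpace N) : ‖ofPer N x‖ = ‖x‖ := by
  rw [← sq_eq_sq₀ (norm_nonneg _) (norm_nonneg _), L2Z_norm_sq, perSpace_norm_sq,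
    sum_zmod_eq_sum_Icc, tsum_eq_sum (s := Finset.Icc (-(N : ℤ)) N)]
  · refine Finset.sum_congr rfl fun k hk => ?_
    rw [Finset.mem_Icc, ← abs_le] at hk
    simp [ofPer, hk]
  · intro k hk
    rw [Finset.mem_Icc, ← abs_le] at hk
    simp [ofPer, hk]

theorem norm_perExt_le (N : ℕ) (f : L2Z) : ‖perExt N f‖ ≤ ‖f‖ := by
  refine le_of_sq_le_sq ?_ (norm_nonneg _)
  rw [L2Z_norm_sq, perSpace_norm_sq, sum_zmod_eq_sum_Icc]
  have hsum : Summable fun k => ‖f k‖ ^ 2 := by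
    simpa using (memℓp_gen_iff (p := 2) (by norm_num)).1 f.2
  refine le_trans (le_of_eq ?_) (hsum.sum_le_tsum (Finset.Icc (-(N : ℤ)) N)
    fun k _ => sq_nonneg _)
  refine Finset.sum_congr rfl fun k hk => ?_
  rw [Finset.mem_Icc, ← abs_le] at hk
  simp only [perExt]
  rw [valMinAbs_intCast_of_abs_le hk]

theorem truncate_sub_ofPer (N : ℕ) (f : L2Z) (x : PerSpace N) :
    truncate N f - ofPer N x = ofPer N (perExt N f - x) := by
  refine lp.ext (funext fun k => ?_)
  rw [lp.coeFn_sub, Pi.sub_apply]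
  simp only [truncate, ofPer]
  split_ifs with h
  · simp only [PiLp.sub_apply, perExt]
    rw [valMinAbs_intCast_of_abs_le h]
  · exact sub_zero _

theorem tendsto_truncate (f : L2Z) : Tendsto (fun N => truncate N f) atTop (𝓝 f) := by
  have h := lp.hasSum_single (p := 2) (by norm_num) f
  have h2 : Tendsto (fun N : ℕ => Finset.Icc (-(N : ℤ)) N) atTop atTop := by
    refine tendsto_atTop_finset_of_monotone (fun N N' hN => ?_) fun k => ⟨k.natAbs, ?_⟩
    · exact Finset.Icc_subset_Icc (by omega) (by omega)
    · rw [Finset.mem_Icc]; omega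
  refine (h.comp h2).congr fun N => lp.ext (funext fun k => ?_)
  rw [Function.comp_apply, lp.coeFn_sum, Finset.sum_apply]
  simp only [truncate, lp.single_apply, Finset.sum_pi_single, Finset.mem_Icc, ← abs_le]

/-! Convergence of the periodic duals -/

theorem frameOp_frameOpInv {ι H : Type*} [NormedAddCommGroup H] [InnerProductSpace ℂ H]
    [CompleteSpace H] {φ : ι → H} {A B : ℝ} (h : IsFrame φ A B) (f : H) :
    frameOp φ (frameOpInv φ f) = f :=
  Function.rightInverse_invFun h.bijective_frameOp.surjective f

section Main

variable {M a : ℕ} {g : Fin M → L2Z} {A B : ℝ} {s : ℕ}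

theorem IsFrame.lower_le_upper {ι H : Type*} [NormedAddCommGroup H] [InnerProductSpace ℂ H]
    {φ : ι → H} (h : IsFrame φ A B) {f : H} (hf : f ≠ 0) : A ≤ B := by
  have h1 := (h.2.2 f).2.1.trans (h.2.2 f).2.2
  exact le_of_mul_le_mul_right h1 (pow_pos (norm_pos_iff.2 hf) 2)

theorem norm_truncate_dualFun_sub_le (ha : 0 < a) (hframe : IsFrame (shiftSystem a g) A B)
    (hnorm : ∀ m, ‖g m‖ = 1) (hsupp : ∀ (m : Fin M) (k : ℤ), (s : ℤ) < |k| → g m k = 0)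
    {N n : ℕ} (haN : a ∣ 2 * N + 1) (hn : s + 2 * s * n ≤ N) (m : Fin M) :
    ‖truncate N (dualFun a g m) - ofPer N (perDual a N g m)‖ ≤
      4 / A * ((√(B / A) - 1) / (√(B / A) + 1)) ^ (n + 1) := by
  have hA := hframe.1
  have hAB : A ≤ B := hframe.lower_le_upper (f := g m) (by
    rw [← norm_pos_iff, hnorm]; exact zero_lt_one)
  have hper : IsFrame (perSystem a N g) A B := by
    simpa using hframe.perSystem ha hsupp (by linarith [Nat.zero_le (2 * s * n)]) (t := 1)
      (by rw [one_mul]; exact addOrderOf_mul_eq_of_dvd haN)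
  obtain ⟨S, hS, hSsa, hSspec, hSb⟩ := hframe.exists_continuousLinearMap
  obtain ⟨T, hT, hTsa, hTspec, hTb⟩ := hper.exists_continuousLinearMap
  obtain ⟨p, hpn, hp⟩ := exists_polynomial_approx_inv hA hAB n
  set q := (√(B / A) - 1) / (√(B / A) + 1) with hq
  have hq0 : 0 ≤ q := by
    refine div_nonneg (sub_nonneg.2 ?_) (by positivity)
    rw [Real.one_le_sqrt]
    exact (one_le_div hA).2 hAB
  have hε : 0 ≤ 2 * q ^ (n + 1) := by positivity
  have hSγ : S (dualFun a g m) = g m := by rw [← hS]; exact frameOp_frameOpInv hframe _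
  have hTγ : T (perDual a N g m) = perExt N (g m) := by
    rw [← hT]; exact frameOp_frameOpInv hper _
  have h1 := norm_sub_aeval_apply_le hSsa hA hSspec hSb hε hp (dualFun a g m)
  have h2 := norm_sub_aeval_apply_le hTsa hA hTspec hTb hε hp (perDual a N g m)
  rw [hSγ, hnorm] at h1
  rw [hTγ, ← perExt_aeval ha hsupp haN hS hT (hsupp m) hpn hn] at h2
  have h3 : ‖perExt N (g m)‖ ≤ 1 := (norm_perExt_le N _).trans (hnorm m).le
  -- The periodized `p(S) g_m`, which equals `p(S_N)` of the periodized `g_m`, is the intermediate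
  -- point.
  have h4 : perExt N (dualFun a g m) - perDual a N g m =
      perExt N (dualFun a g m - Polynomial.aeval S p (g m)) -
        (perDual a N g m - perExt N (Polynomial.aeval S p (g m))) := by
    rw [← perExtLinear_apply, ← perExtLinear_apply, ← perExtLinear_apply, map_sub]
    abel
  rw [truncate_sub_ofPer, norm_ofPer, h4]
  calc _ ≤ _ := norm_sub_le _ _
    _ ≤ 2 * q ^ (n + 1) / A * 1 + 2 * q ^ (n + 1) / A * 1 := by
      gcongr
      · exact (norm_perExt_le N _).trans h1
      · refine h2.trans ?_
        gcongr
    _ = _ := by ring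

theorem tendsto_ofPer_perDual (ha : 0 < a) (hframe : IsFrame (shiftSystem a g) A B)
    (hnorm : ∀ m, ‖g m‖ = 1) (hsupp : ∀ (m : Fin M) (k : ℤ), (s : ℤ) < |k| → g m k = 0)
    (m : Fin M) :
    Tendsto (fun N : ℕ => ofPer N (perDual a N g m)) (atTop ⊓ 𝓟 {N : ℕ | a ∣ 2 * N + 1})
      (𝓝 (dualFun a g m)) := by
  have hA := hframe.1
  have hAB : A ≤ B := hframe.lower_le_upper (f := g m) (by
    rw [← norm_pos_iff, hnorm]; exact zero_lt_one)
  -- Enlarging `s` to `s + 1` covers `s = 0`, where the degree `(N - s) / (2s)` would be a division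
  -- by zero.
  have hsupp' : ∀ (m : Fin M) (k : ℤ), ((s + 1 : ℕ) : ℤ) < |k| → g m k = 0 := fun m k hk =>
    hsupp m k (by push_cast at hk; omega)
  set q := (√(B / A) - 1) / (√(B / A) + 1) with hq
  have hκ : 1 ≤ √(B / A) := by
    rw [Real.one_le_sqrt]
    exact (one_le_div hA).2 hAB
  have hq0 : 0 ≤ q := div_nonneg (sub_nonneg.2 hκ) (by positivity)
  have hq1 : q < 1 := by
    rw [hq, div_lt_one (by positivity)]
    linarith
  set l : ℕ → ℕ := fun N => (N - (s + 1)) / (2 * (s + 1)) with hl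
  have hlt : Tendsto l atTop atTop :=
    (Nat.tendsto_div_const_atTop (by omega)).comp (tendsto_sub_atTop_nat (s + 1))
  have hbound : Tendsto (fun N => 4 / A * q ^ (l N + 1)) atTop (𝓝 0) := by
    have h := (tendsto_pow_atTop_nhds_zero_of_lt_one hq0 hq1).comp
      ((tendsto_add_atTop_nat 1).comp hlt)
    simpa using h.const_mul (4 / A)
  have hdiff : Tendsto (fun N => truncate N (dualFun a g m) - ofPer N (perDual a N g m))
      (atTop ⊓ 𝓟 {N : ℕ | a ∣ 2 * N + 1}) (𝓝 0) := by
    refine squeeze_zero_norm' ?_ (hbound.mono_left inf_le_left)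
    rw [eventually_inf_principal]
    filter_upwards [eventually_ge_atTop (s + 1)] with N hN haN
    refine norm_truncate_dualFun_sub_le ha hframe hnorm hsupp' haN ?_ m
    have := Nat.mul_div_le (N - (s + 1)) (2 * (s + 1))
    simp only [hl]
    omega
  have := ((tendsto_truncate (dualFun a g m)).mono_left inf_le_left).sub hdiff
  simpa using this

end Main

/-! ### The explicit rate and the main theorem -/

theorem pow_le_rpow_pow {q : ℝ} (hq0 : 0 ≤ q) (hq1 : q ≤ 1) {s : ℕ} (hs : 0 < s) {N n : ℕ}
    (h : N ≤ 2 * s * n) : q ^ n ≤ (q ^ (1 / (2 * (s : ℝ)))) ^ N := by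
  have hlam0 : 0 ≤ q ^ (1 / (2 * (s : ℝ))) := Real.rpow_nonneg hq0 _
  have hlam1 : q ^ (1 / (2 * (s : ℝ))) ≤ 1 := Real.rpow_le_one hq0 hq1 (by positivity)
  have hpow : (q ^ (1 / (2 * (s : ℝ)))) ^ (2 * s) = q := by
    rw [← Real.rpow_mul_natCast hq0]
    push_cast
    rw [one_div_mul_cancel (by positivity), Real.rpow_one]
  calc q ^ n = (q ^ (1 / (2 * (s : ℝ)))) ^ (2 * s * n) := by rw [pow_mul, hpow]
    _ ≤ _ := pow_le_pow_of_le_one hlam0 hlam1 h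

theorem theorem2 (M a : ℕ) (ha : 0 < a) (g : Fin M → L2Z) (A B : ℝ)
    (hframe : IsFrame (shiftSystem a g) A B)
    (hnorm : ∀ m, ‖g m‖ = 1)
    (s : ℕ) (hsupp : ∀ (m : Fin M) (k : ℤ), (s : ℤ) < |k| → g m k = 0)
    (κ q lam C : ℝ) (hκ : κ = B / A)
    (hq : q = (Real.sqrt κ - 1) / (Real.sqrt κ + 1))
    (hlam : lam = q ^ (1 / (2 * (s : ℝ))))
    (hC : C = 1 / A * max (2 * κ) ((1 + Real.sqrt κ) ^ 2)) :
    (∀ N : ℕ, 2 * s < N → Function.Bijective (frameOp (perSystem a N g))) ∧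
    (∀ m : Fin M, Tendsto (fun N : ℕ => ofPer N (perDual a N g m))
      (atTop ⊓ 𝓟 {N : ℕ | a ∣ 2 * N + 1}) (𝓝 (dualFun a g m))) ∧
    (0 < s → ∀ N : ℕ, 3 * s < N → a ∣ 2 * N + 1 → ∀ m : Fin M,
      ‖truncate N (dualFun a g m) - ofPer N (perDual a N g m)‖ ≤
        3 * Real.sqrt 2 * C * lam ^ N * ((lam ^ s - lam ^ (s + 1)) ^ 3)⁻¹) := by
  refine ⟨fun N hN => ?_, tendsto_ofPer_perDual ha hframe hnorm hsupp, fun hs N hN haN m => ?_⟩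
  · obtain ⟨t, ht⟩ := exists_addOrderOf_mul_eq a N
    exact (hframe.perSystem ha hsupp (by omega) ht).bijective_frameOp
  have hA := hframe.1
  have hAB : A ≤ B := hframe.lower_le_upper (f := g m) (by
    rw [← norm_pos_iff, hnorm]; exact zero_lt_one)
  have hκ1 : 1 ≤ √κ := by
    rw [Real.one_le_sqrt, hκ]
    exact (one_le_div hA).2 hAB
  have hq0 : 0 ≤ q := hq ▸ div_nonneg (sub_nonneg.2 hκ1) (by positivity)
  have hq1 : q < 1 := by
    rw [hq, div_lt_one (by positivity)]
    linarith
  have hdiv := Nat.mul_div_le (N - s) (2 * s)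
  have hmain := norm_truncate_dualFun_sub_le ha hframe hnorm hsupp haN
    -- The largest degree with `s + 2sn ≤ N`; rounding down costs nothing, because `2s(n + 1) ≥ N -
    -- s`.
    (n := (N - s) / (2 * s)) (by omega) m
  rw [← hκ, ← hq] at hmain
  refine hmain.trans ?_
  have hexp : N - s ≤ 2 * s * ((N - s) / (2 * s) + 1) := by
    have := Nat.lt_mul_div_succ (N - s) (show 0 < 2 * s by omega)
    omega
  have hqlam := pow_le_rpow_pow hq0 hq1.le hs hexp
  rw [← hlam] at hqlam
  have hlam0 : 0 ≤ lam := hlam ▸ Real.rpow_nonneg hq0 _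
  have hlam1 : lam < 1 := by
    rw [hlam]; exact Real.rpow_lt_one hq0 hq1 (by positivity)
  -- For `lam = 0` the inverse on the right is `0⁻¹ = 0`, so the left side must be shown to vanish
  -- exactly.
  rcases hlam0.eq_or_lt with h0 | hpos
  · rw [← h0, zero_pow (by omega)] at hqlam
    have hz : q ^ ((N - s) / (2 * s) + 1) = 0 := le_antisymm hqlam (pow_nonneg hq0 _)
    rw [hz, ← h0, zero_pow (by omega : N ≠ 0)]
    simp
  -- `κ ≥ 1` gives `(1 + √κ) ^ 2 ≥ 4`.
  have hC4 : 4 / A ≤ C := by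
    rw [hC, div_eq_mul_one_div, mul_comm]
    gcongr
    exact le_max_of_le_right (by nlinarith)
  have hC0 : 0 ≤ C := le_trans (by positivity) hC4
  have hgap : 0 < lam ^ s - lam ^ (s + 1) := by
    rw [pow_succ]
    nlinarith [pow_pos hpos s]
  -- The bound obtained is `C lam ^ (N - s)`; this shows that the claimed one, with its cubed gap in
  -- the denominator, is weaker.
  have hgap1 : (lam ^ s - lam ^ (s + 1)) ^ 3 ≤ lam ^ s := by
    calc _ ≤ (lam ^ s) ^ 3 := by
          gcongr
          linarith [pow_pos hpos (s + 1)]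
      _ = lam ^ (s * 3) := (pow_mul _ _ _).symm
      _ ≤ lam ^ s := pow_le_pow_of_le_one hlam0 hlam1.le (by omega)
  have hsplit : lam ^ (N - s) = lam ^ N * (lam ^ s)⁻¹ := by
    rw [← div_eq_mul_inv, eq_div_iff (pow_pos hpos s).ne', ← pow_add]
    congr 1
    omega
  have hsqrt : 1 ≤ 3 * √2 := by
    have : (1 : ℝ) ≤ √2 := Real.one_le_sqrt.2 (by norm_num)
    linarith
  calc _ ≤ C * lam ^ (N - s) := by gcongr
    _ = 1 * C * lam ^ N * (lam ^ s)⁻¹ := by rw [hsplit]; ring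
    _ ≤ _ := by gcongr
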